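/- Let $n$ be a natural number, let $M \subset \mathbb{R}^{n}$ be a nonempty connected open set with standard volume form $\omega = du^{1}\wedge\dots\wedge du^{n}$, and let $\Psi$ be the standard volume form on $\mathbb{R}^{n+1}$. Let $\mu$ be the $n$-form on $\mathbb{R}^{n+1}$ obtained by interior multiplication of $\Psi$ with the radial (position) vector field, that is, $\mu_{y}(X_{1},\dots,X_{n}) = \Psi(y, X_{1},\dots,X_{n})$. Let $A : M \to \mathbb{R}^{n+1}$ be a smooth centroaffine immersion (an immersion with $A(u) \neq 0$ and $A(u) \notin dA_{u}(\mathbb{R}^{n})$ for all $u \in M$) satisfying $A^{\ast}(\mu) = \kappa\,\omega$ for a nonzero constant $\kappa$, and let $Q \in C^{\infty}(M)$. Equip $M \times \mathbb{R}^{n+1\,\ast}$ with the standard flat affine connection and the parallel volume form $\Upsilon = du^{1}\wedge\dots\wedge du^{n}\wedge dx_{1}\wedge\dots\wedge dx_{n+1}$, where $x_{1},\dots,x_{n+1}$ are the coordinates on $\mathbb{R}^{n+1\,\ast}$ dual to the standard ones, and define $F : M \times \mathbb{R}^{n+1\,\ast} \to \mathbb{R}$ by $F(u,x) = \langle A(u),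 x\rangle + Q(u)$. Let $\Sigma$ be a connected component of a nonempty level set of $F$. Then $\Sigma$ is an affine sphere if and only if the image of $A$ is contained in an affine hyperplane of $\mathbb{R}^{n+1}$; and if $\Sigma$ is an affine sphere, then it is improper. Here an affine sphere is a smooth hypersurface with nondegenerate second fundamental form whose equiaffine shape operator $S$ is at each point a multiple of the identity, and it is improper if this multiple is zero. The equiaffine shape operator is defined by $\widehat{\nabla}_{X}W = -S(X) + \tau(X)W$, where $\widehat{\nabla}$ is the flat connection, $S(X)$ is tangent to $\Sigma$, and $W$ is the equiaffine normal. This is the transverse vector field along $\Sigma$, unique up to sign, such that the connection $\nabla$ and the metric $h$ induced by $\widehat{\nabla}_{X}Y = \nabla_{X}Y + h(X,Y)W$ on $\Sigma$ have the following property: the volume densities of $h$ and of the interior product of $W$ with $\Upsilon$ coincide and are $\nabla$-parallel. -/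

import Mathlib

open scoped ContDiff

noncomputable section

namespace EquiaffineLevelSets

/-! ### Hypersurfaces of a flat affine space -/

section Hypersurface

variable {E : Type*} [NormedAddCommGroup E] [NormedSpace ℝ E]

/-- `S` is a smooth embedded hypersurface: near each of its points it is the zero set of a smooth
function without critical points. -/
def IsSmoothHypersurface (S : Set E) : Prop :=
  ∀ p ∈ S, ∃ (U : Set E) (G : E → ℝ), IsOpen U ∧ p ∈ U ∧ ContDiffOn ℝ ∞ G U ∧
    (∀ x ∈ U, fderiv ℝ G x ≠ 0) ∧ S ∩ U = {x ∈ U | G x = 0}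

/-- The tangent space of the submanifold `S` at `p`, as a subspace of the ambient space: the common
kernel of the differentials at `p` of all smooth functions defined near `p` that vanish on `S`. -/
def tangentSpaceAt (S : Set E) (p : E) : Submodule ℝ E where
  carrier := {v | ∀ (U : Set E) (G : E → ℝ), IsOpen U → p ∈ U → ContDiffOn ℝ ∞ G U →
    (∀ x ∈ S ∩ U, G x = 0) → fderiv ℝ G p v = 0}
  add_mem' := by
    intro v w hv hw U G hU hp hG h0
    rw [map_add, hv U G hU hp hG h0, hw U G hU hp hG h0, add_zero]
  zero_mem' := by
    intro U G _ _ _ _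
    exact map_zero _
  smul_mem' := by
    intro c v hv U G hU hp hG h0
    rw [map_smul, hv U G hU hp hG h0, smul_zero]

/-- `X` is (an extension to the open set `U` of) a smooth vector field tangent to `S` on `S ∩ U`. -/
def IsTangentField (S U : Set E) (X : E → E) : Prop :=
  IsOpen U ∧ ContDiffOn ℝ ∞ X U ∧ ∀ x ∈ S ∩ U, X x ∈ tangentSpaceAt S x

/-- Nondegeneracy of the second fundamental form of `S`. The flat derivative of a field `Y` along
`v` is `fderiv ℝ Y p v`, and the second fundamental form evaluated on tangent `v`, `Y` is its class
modulo the tangent space: no nonzero tangent vector `v` pairs to zero with all tangent fields. -/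
def IsNondegenerate (S : Set E) : Prop :=
  ∀ p ∈ S, ∀ v ∈ tangentSpaceAt S p, v ≠ 0 →
    ∃ (U : Set E) (Y : E → E), p ∈ U ∧ IsTangentField S U Y ∧
      fderiv ℝ Y p v ∉ tangentSpaceAt S p

/-- `ξ` is a smooth vector field along `S` that is transverse to `S`. A smooth field along an
embedded hypersurface is the restriction of a smooth field on an open neighborhood; the quantities
formed below from `ξ` only use derivatives of `ξ` in directions tangent to `S`. -/
def IsTransversal (S : Set E) (ξ : E → E) : Prop :=
  (∃ U : Set E, IsOpen U ∧ S ⊆ U ∧ ContDiffOn ℝ ∞ ξ U) ∧ ∀ p ∈ S, ξ p ∉ tangentSpaceAt S p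

open Classical in
/-- The linear form on the ambient space that vanishes on the tangent space at `p` and is `1` on
`ξ p`. When `S` is a hypersurface and `ξ p` is transverse to `S`, it exists and is unique, and
`w = (w - conormal S ξ p w • ξ p) + conormal S ξ p w • ξ p` is the decomposition of `w` into its
tangential part and its part along `ξ p`. -/
def conormal (S : Set E) (ξ : E → E) (p : E) : E →ₗ[ℝ] ℝ :=
  if h : ∃ ν : E →ₗ[ℝ] ℝ, (∀ v ∈ tangentSpaceAt S p, ν v = 0) ∧ ν (ξ p) = 1 then h.choose else 0

/-- The representative `h(X, Y)` of the second fundamental form with respect to `ξ`, at `p`: the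
coefficient of `ξ` in the flat derivative of `Y` along `X`. -/
def secondForm (S : Set E) (ξ X Y : E → E) (p : E) : ℝ :=
  conormal S ξ p (fderiv ℝ Y p (X p))

/-- The connection `∇_X Y` induced on `S` via `ξ`, at `p`: the tangential part of the flat
derivative of `Y` along `X`. -/
def inducedConnection (S : Set E) (ξ X Y : E → E) (p : E) : E :=
  fderiv ℝ Y p (X p) - secondForm S ξ X Y p • ξ p

/-- The connection one-form `τ` of `ξ`, at `p`. -/
def connectionForm (S : Set E) (ξ : E → E) (p v : E) : ℝ :=
  conormal S ξ p (fderiv ℝ ξ p v)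

/-- The shape operator of `ξ` at `p`, determined by `D_v ξ = - shape v + τ(v) ξ`. -/
def shapeOperator (S : Set E) (ξ : E → E) (p v : E) : E :=
  connectionForm S ξ p v • ξ p - fderiv ℝ ξ p v

/-- The volume form induced on `S` by the transversal `ξ` and the ambient volume form `Ψ`:
interior multiplication of `Ψ` with `ξ`, at `p`. -/
def inducedVolume {m : ℕ} (Ψ : E [⋀^Fin (m + 1)]→ₗ[ℝ] ℝ) (ξ : E → E) (p : E) :
    E [⋀^Fin m]→ₗ[ℝ] ℝ :=
  Ψ.curryLeft (ξ p)

/-- `ξ` is an equiaffine normal of the hypersurface `S` (unique up to sign on a connected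
nondegenerate `S`): it is transversal, the volume density `|Ψ(ξ, ·)|` it induces equals the volume
density `|det h| ^ (1 / 2)` of the metric `h` it induces, and this volume is parallel for the
connection that it induces. -/
structure IsEquiaffineNormal {m : ℕ} (Ψ : E [⋀^Fin (m + 1)]→ₗ[ℝ] ℝ) (S : Set E) (ξ : E → E) :
    Prop where
  transversal : IsTransversal S ξ
  volume_eq : ∀ (U : Set E) (X : Fin m → E → E), (∀ i, IsTangentField S U (X i)) →
    ∀ p ∈ S ∩ U, |inducedVolume Ψ ξ p (fun i => X i p)| =
      √|(Matrix.of fun i j => secondForm S ξ (X i) (X j) p).det|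
  volume_parallel : ∀ (U : Set E) (Y : E → E) (X : Fin m → E → E), IsTangentField S U Y →
    (∀ i, IsTangentField S U (X i)) → ∀ p ∈ S ∩ U,
      fderiv ℝ (fun x => inducedVolume Ψ ξ x (fun i => X i x)) p (Y p) =
        ∑ i, inducedVolume Ψ ξ p
          (Function.update (fun j => X j p) i (inducedConnection S ξ Y (X i) p))

/-- `S` is an affine sphere: a nondegenerate hypersurface whose equiaffine shape operator is, at
each point, a multiple of the identity. -/
def IsAffineSphere {m : ℕ} (Ψ : E [⋀^Fin (m + 1)]→ₗ[ℝ] ℝ) (S : Set E) : Prop :=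
  IsSmoothHypersurface S ∧ IsNondegenerate S ∧
    ∃ ξ : E → E, IsEquiaffineNormal Ψ S ξ ∧
      ∀ p ∈ S, ∃ c : ℝ, ∀ v ∈ tangentSpaceAt S p, shapeOperator S ξ p v = c • v

/-- `S` is an improper affine sphere: an affine sphere for which the multiple is zero. -/
def IsImproperAffineSphere {m : ℕ} (Ψ : E [⋀^Fin (m + 1)]→ₗ[ℝ] ℝ) (S : Set E) : Prop :=
  IsSmoothHypersurface S ∧ IsNondegenerate S ∧
    ∃ ξ : E → E, IsEquiaffineNormal Ψ S ξ ∧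
      ∀ p ∈ S, ∀ v ∈ tangentSpaceAt S p, shapeOperator S ξ p v = 0

end Hypersurface

/-! ### Centroaffine immersions and the function `F` -/

/-- The standard volume form of `ℝⁿ`. -/
def stdVolume (n : ℕ) : (Fin n → ℝ) [⋀^Fin n]→ₗ[ℝ] ℝ := (Pi.basisFun ℝ (Fin n)).det

/-- The `n`-form on `ℝⁿ⁺¹` obtained by interior multiplication of the standard volume form with
the radial (position) vector field, at the point `y`. -/
def radialForm (n : ℕ) (y : Fin (n + 1) → ℝ) : (Fin (n + 1) → ℝ) [⋀^Fin n]→ₗ[ℝ] ℝ :=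
  (stdVolume (n + 1)).curryLeft y

/-- The pullback of the form `radialForm` by the map `A`, at the point `u`. -/
def pullbackRadialForm {n : ℕ} (A : (Fin n → ℝ) → (Fin (n + 1) → ℝ)) (u : Fin n → ℝ) :
    (Fin n → ℝ) [⋀^Fin n]→ₗ[ℝ] ℝ :=
  (radialForm n (A u)).compLinearMap (fderiv ℝ A u).toLinearMap

/-- `A` is a centroaffine immersion on the open set `M`: a smooth immersion that avoids the origin
and is everywhere transverse to the radial vector field. -/
structure IsCentroaffineImmersion {n : ℕ} (M : Set (Fin n → ℝ))
    (A : (Fin n → ℝ) → (Fin (n + 1) → ℝ)) : Prop where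
  smooth : ContDiffOn ℝ ∞ A M
  immersion : ∀ u ∈ M, Function.Injective (fderiv ℝ A u)
  ne_zero : ∀ u ∈ M, A u ≠ 0
  transverse : ∀ u ∈ M, A u ∉ Set.range (fderiv ℝ A u)

/-- The product `ℝⁿ × ℝⁿ⁺¹*`; a linear form on `ℝⁿ⁺¹` is given by its components `x₁, …, xₙ₊₁`
in the basis dual to the standard one. -/
abbrev Ambient (n : ℕ) : Type := (Fin n → ℝ) × (Fin (n + 1) → ℝ)

/-- The parallel volume form `du¹ ∧ ⋯ ∧ duⁿ ∧ dx₁ ∧ ⋯ ∧ dxₙ₊₁` of `ℝⁿ × ℝⁿ⁺¹*`. -/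
def ambientVolume (n : ℕ) : Ambient n [⋀^Fin (n + n + 1)]→ₗ[ℝ] ℝ :=
  (((Pi.basisFun ℝ (Fin n)).prod (Pi.basisFun ℝ (Fin (n + 1)))).reindex
    (finSumFinEquiv : Fin n ⊕ Fin (n + 1) ≃ Fin (n + (n + 1)))).det

/-- The function `F(u, x) = ⟨A(u), x⟩ + Q(u)`. -/
def pairingFunction {n : ℕ} (A : (Fin n → ℝ) → (Fin (n + 1) → ℝ)) (Q : (Fin n → ℝ) → ℝ)
    (z : Ambient n) : ℝ :=
  ∑ i, A z.1 i * z.2 i + Q z.1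

/-- The level set at level `t` of `F` as a function on `M × ℝⁿ⁺¹*`. -/
def levelSet {n : ℕ} (M : Set (Fin n → ℝ)) (A : (Fin n → ℝ) → (Fin (n + 1) → ℝ))
    (Q : (Fin n → ℝ) → ℝ) (t : ℝ) : Set (Ambient n) :=
  {z | z.1 ∈ M ∧ pairingFunction A Q z = t}

/-- The image of `M` under `A` is contained in an affine hyperplane. -/
def ImageInHyperplane {n : ℕ} (M : Set (Fin n → ℝ)) (A : (Fin n → ℝ) → (Fin (n + 1) → ℝ)) :
    Prop :=
  ∃ (a : Fin (n + 1) → ℝ) (c : ℝ), a ≠ 0 ∧ A '' M ⊆ {y | ∑ i, y i * a i = c}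

end EquiaffineLevelSets

end

/-! The function `F` is affine along the fibers of the projection to `M`. Hence `dF(0, η) = ⟨A, η⟩`,
and its Hessian pairs `w` with `(0, η)` to `⟨dA(w.1), η⟩`; vertical directions are isotropic.
Bordering the Hessian by `dF` gives a matrix whose determinant is, up to sign, the square of `det
(A, ∂₁A, …, ∂ₙA)`, which is `κ ^ 2`; `Q` drops out (`sq_ambientVolume_eq`).

For a transversal `ξ` the induced metric is `-Hess F / dF(ξ)` on `ker dF`. Equality of the volume
densities therefore says `dF(ξ) ^ (2n + 2) = κ ^ 2`, so `dF(ξ)` is locally constant on the level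
set. Parallelism of the volume says `dF(D_v ξ) = 0` for tangent `v`. Differentiating `dF(ξ)` along
`v` leaves `Hess F(v, ξ) = 0`, which forces `ξ` to be vertical and to annihilate the image of `dA`
(`IsEquiaffineNormal.vertical`): it is a conormal of `A`.

The shape operator `-Dξ` then has vertical values, so it is a multiple of the identity only if it is
zero. In that case `ξ` is a constant covector annihilating `dA`, and `A` stays in one of its level
hyperplanes. Conversely, the covector of a hyperplane containing the image, suitably scaled, is a
constant equiaffine normal. -/

noncomputable section

namespace EquiaffineLevelSets

/-! ### Hypersurfaces whose tangent spaces are kernels of a differential -/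

section General

variable {E : Type*} [NormedAddCommGroup E] [NormedSpace ℝ E]

/-- `S` is contained in the open set `D`, on which `F` is smooth, and the tangent spaces of `S` are
the kernels of the differential of `F`. -/
structure IsDefinedBy (S D : Set E) (F : E → ℝ) : Prop where
  isOpen : IsOpen D
  subset : S ⊆ D
  smooth : ContDiffOn ℝ ∞ F D
  mem_tangent : ∀ p ∈ S, ∀ v, v ∈ tangentSpaceAt S p ↔ fderiv ℝ F p v = 0

variable {S D : Set E} {F : E → ℝ}

theorem ContDiffOn.differentiableAt_of_isOpen {G : Type*} [NormedAddCommGroup G] [NormedSpace ℝ G]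
    {U : Set E} {X : E → G} (hX : ContDiffOn ℝ ∞ X U) (hU : IsOpen U) {p : E} (hp : p ∈ U) :
    DifferentiableAt ℝ X p :=
  (hX.contDiffAt (hU.mem_nhds hp)).differentiableAt (by simp)

theorem IsDefinedBy.contDiffOn_fderiv (h : IsDefinedBy S D F) : ContDiffOn ℝ ∞ (fderiv ℝ F) D :=
  h.smooth.fderiv_of_isOpen h.isOpen (by simp)

theorem IsDefinedBy.fderiv_comm (h : IsDefinedBy S D F) {p : E} (hp : p ∈ D) (v w : E) :
    fderiv ℝ (fderiv ℝ F) p v w = fderiv ℝ (fderiv ℝ F) p w v :=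
  (h.smooth.contDiffAt (h.isOpen.mem_nhds hp)).isSymmSndFDerivAt
    (by
      rw [minSmoothness_of_isRCLikeNormedField]
      exact WithTop.coe_le_coe.2 (le_top : (2 : ℕ∞) ≤ ⊤)) v w

theorem IsDefinedBy.fderiv_apply (h : IsDefinedBy S D F) {U : Set E} {X : E → E}
    (hU : IsOpen U) (hX : ContDiffOn ℝ ∞ X U) {p : E} (hp : p ∈ S ∩ U) (v : E) :
    fderiv ℝ (fun x => fderiv ℝ F x (X x)) p v =
      fderiv ℝ (fderiv ℝ F) p v (X p) + fderiv ℝ F p (fderiv ℝ X p v) := by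
  have h1 := (ContDiffOn.differentiableAt_of_isOpen h.contDiffOn_fderiv h.isOpen
    (h.subset hp.1)).hasFDerivAt
  have h2 := (ContDiffOn.differentiableAt_of_isOpen hX hU hp.2).hasFDerivAt
  rw [(h1.clm_apply h2).fderiv]
  simp [add_comm]

/-- The derivative of a tangent field along a tangent vector has the second derivative of the
defining function as its normal component. -/
theorem IsDefinedBy.fderiv_tangentField (h : IsDefinedBy S D F) {U : Set E} {X : E → E}
    (hX : IsTangentField S U X) {p : E} (hp : p ∈ S ∩ U) {v : E} (hv : fderiv ℝ F p v = 0) :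
    fderiv ℝ F p (fderiv ℝ X p v) = - fderiv ℝ (fderiv ℝ F) p v (X p) := by
  obtain ⟨hU, hXs, hXt⟩ := hX
  have h0 := (h.mem_tangent p hp.1 v).2 hv (D ∩ U) (fun x => fderiv ℝ F x (X x))
    (h.isOpen.inter hU) ⟨h.subset hp.1, hp.2⟩
    ((h.contDiffOn_fderiv.mono Set.inter_subset_left).clm_apply (hXs.mono Set.inter_subset_right))
    (fun x hx => (h.mem_tangent x hx.1 _).1 (hXt x ⟨hx.1, hx.2.2⟩))
  rw [h.fderiv_apply hU hXs hp] at h0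
  linarith

/-- Both sides vanish on `ker dF` and are `1` on `ξ p`, so the choice made in `conormal` is
immaterial. -/
theorem IsDefinedBy.conormal_eq (h : IsDefinedBy S D F) {ξ : E → E} {p : E} (hp : p ∈ S)
    (hξ : fderiv ℝ F p (ξ p) ≠ 0) (w : E) :
    conormal S ξ p w = fderiv ℝ F p w / fderiv ℝ F p (ξ p) := by
  have hex : ∃ ν : E →ₗ[ℝ] ℝ, (∀ v ∈ tangentSpaceAt S p, ν v = 0) ∧ ν (ξ p) = 1 := by
    refine ⟨(fderiv ℝ F p (ξ p))⁻¹ • (fderiv ℝ F p : E →ₗ[ℝ] ℝ), fun v hv => ?_, ?_⟩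
    · simp [(h.mem_tangent p hp v).1 hv]
    · simp [hξ]
  rw [conormal, dif_pos hex]
  obtain ⟨h0, h1⟩ := hex.choose_spec
  have hw := h0 (w - (fderiv ℝ F p w / fderiv ℝ F p (ξ p)) • ξ p)
    ((h.mem_tangent p hp _).2 (by simp [hξ]))
  rw [map_sub, map_smul, h1] at hw
  simpa [sub_eq_zero] using hw

theorem IsDefinedBy.secondForm_eq (h : IsDefinedBy S D F) {ξ : E → E} {U : Set E} {X Y : E → E}
    (hX : IsTangentField S U X) (hY : IsTangentField S U Y) {p : E} (hp : p ∈ S ∩ U)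
    (hξ : fderiv ℝ F p (ξ p) ≠ 0) :
    secondForm S ξ X Y p = - (fderiv ℝ F p (ξ p))⁻¹ * fderiv ℝ (fderiv ℝ F) p (X p) (Y p) := by
  rw [secondForm, h.conormal_eq hp.1 hξ,
    h.fderiv_tangentField hY hp ((h.mem_tangent p hp.1 _).1 (hX.2.2 p hp))]
  field_simp

theorem IsDefinedBy.fderiv_apply_ne_zero (h : IsDefinedBy S D F) {ξ : E → E}
    (hξ : IsTransversal S ξ) {p : E} (hp : p ∈ S) : fderiv ℝ F p (ξ p) ≠ 0 :=
  fun h0 => hξ.2 p hp ((h.mem_tangent p hp _).2 h0)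

theorem IsDefinedBy.det_secondForm (h : IsDefinedBy S D F) {m : ℕ} {ξ : E → E} {U : Set E}
    {X : Fin m → E → E} (hX : ∀ i, IsTangentField S U (X i)) {p : E} (hp : p ∈ S ∩ U)
    (hξ : fderiv ℝ F p (ξ p) ≠ 0) :
    |(Matrix.of fun i j => secondForm S ξ (X i) (X j) p).det| * |fderiv ℝ F p (ξ p)| ^ m =
      |(Matrix.of fun i j => fderiv ℝ (fderiv ℝ F) p (X i p) (X j p)).det| := by
  have : (Matrix.of fun i j => secondForm S ξ (X i) (X j) p) = (-(fderiv ℝ F p (ξ p))⁻¹) •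
      (Matrix.of fun i j => fderiv ℝ (fderiv ℝ F) p (X i p) (X j p)) := by
    ext i j
    simp [h.secondForm_eq (hX i) (hX j) hp hξ]
  have h' := abs_ne_zero.2 hξ
  rw [this, Matrix.det_smul, abs_mul, abs_pow, abs_neg, abs_inv, Fintype.card_fin,
    mul_right_comm, ← mul_pow, inv_mul_cancel₀ h', one_pow, one_mul]

/-- Allows the flat derivative to replace the induced connection inside the induced volume: the two
differ by a multiple of `ξ`. -/
theorem curryLeft_update_self {m : ℕ} (b : Module.Basis (Fin (m + 1)) ℝ E) (w : E) (x : Fin m → E)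
    (i : Fin m) : b.det.curryLeft w (Function.update x i w) = 0 := by
  rw [AlternatingMap.curryLeft_apply_apply]
  exact b.det.map_eq_zero_of_eq _ (i := 0) (j := i.succ) (by simp) (Fin.succ_ne_zero i).symm

/-! ### Derivatives of determinants and parallel induced volumes -/

variable [FiniteDimensional ℝ E] {m : ℕ}

theorem continuous_basis_det {ι : Type*} [Fintype ι] [DecidableEq ι] (b : Module.Basis ι ℝ E) :
    Continuous fun v : ι → E => b.det v := by
  simp only [Module.Basis.det_apply]
  refine Continuous.matrix_det (continuous_matrix fun i j => ?_)
  exact (b.coord i).continuous_of_finiteDimensional.comp (continuous_apply j)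

/-- The Leibniz rule for the determinant of vector fields. -/
theorem fderiv_basis_det {ι : Type*} [Fintype ι] [DecidableEq ι] (b : Module.Basis ι ℝ E)
    {X : ι → E → E} {p : E} (hX : ∀ i, DifferentiableAt ℝ (X i) p) (v : E) :
    fderiv ℝ (fun x => b.det fun i => X i x) p v =
      ∑ i, b.det (Function.update (fun j => X j p) i (fderiv ℝ (X i) p v)) := by
  let f : ContinuousMultilinearMap ℝ (fun _ : ι => E) ℝ :=
    ⟨b.det.toMultilinearMap, continuous_basis_det b⟩
  have := (HasFDerivAt.multilinear_comp f (fun i => (hX i).hasFDerivAt)).fderiv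
  have h2 : (fun x => b.det fun i => X i x) = fun x => f fun i => X i x := rfl
  rw [h2, this]
  simp only [sum_apply, ContinuousLinearMap.comp_apply,
    ContinuousMultilinearMap.toContinuousLinearMap_apply]
  rfl

theorem fderiv_inducedVolume (b : Module.Basis (Fin (m + 1)) ℝ E) {ξ : E → E}
    {X : Fin m → E → E} {p : E} (hξ : DifferentiableAt ℝ ξ p)
    (hX : ∀ i, DifferentiableAt ℝ (X i) p) (v : E) :
    fderiv ℝ (fun x => inducedVolume b.det ξ x fun i => X i x) p v =
      b.det.curryLeft (fderiv ℝ ξ p v) (fun i => X i p) +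
        ∑ i, inducedVolume b.det ξ p
          (Function.update (fun j => X j p) i (fderiv ℝ (X i) p v)) := by
  have h1 : ∀ x, (inducedVolume b.det ξ x fun i => X i x) =
      b.det fun i => (Fin.cons ξ X : Fin (m + 1) → E → E) i x := by
    intro x
    rw [inducedVolume, AlternatingMap.curryLeft_apply_apply]
    congr 1
    ext i
    refine Fin.cases ?_ (fun i => ?_) i <;> simp
  have h2 : (fun j => (Fin.cons ξ X : Fin (m + 1) → E → E) j p) =
      Fin.cons (ξ p) fun j => X j p := by
    ext i
    refine Fin.cases ?_ (fun i => ?_) i <;> simp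
  simp only [h1]
  rw [fderiv_basis_det b (fun i => Fin.cases hξ hX i), Fin.sum_univ_succ, h2]
  simp only [Fin.cons_zero, Fin.cons_succ, Fin.update_cons_zero, inducedVolume,
    AlternatingMap.curryLeft_apply_apply, ← Fin.cons_update]
  rfl

/-- The induced volume is parallel along `v` precisely when the derivative of the transversal along
`v` has no component along the transversal. -/
theorem fderiv_inducedVolume_eq_iff (b : Module.Basis (Fin (m + 1)) ℝ E) {ξ Y : E → E}
    {X : Fin m → E → E} {p : E} (hξ : DifferentiableAt ℝ ξ p)
    (hX : ∀ i, DifferentiableAt ℝ (X i) p) :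
    fderiv ℝ (fun x => inducedVolume b.det ξ x (fun i => X i x)) p (Y p) =
        ∑ i, inducedVolume b.det ξ p
          (Function.update (fun j => X j p) i (inducedConnection S ξ Y (X i) p)) ↔
      b.det.curryLeft (fderiv ℝ ξ p (Y p)) (fun i => X i p) = 0 := by
  rw [fderiv_inducedVolume b hξ hX]
  have : ∀ i, inducedVolume b.det ξ p
      (Function.update (fun j => X j p) i (inducedConnection S ξ Y (X i) p)) =
      inducedVolume b.det ξ p
          (Function.update (fun j => X j p) i (fderiv ℝ (X i) p (Y p))) := by
    intro i
    rw [inducedConnection, AlternatingMap.map_update_sub, AlternatingMap.map_update_smul,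
      inducedVolume, curryLeft_update_self]
    simp
  simp only [this, add_eq_right]

end General

/-! ### Bordered Gram determinants -/

section Bordered

/-- The square matrix `H` bordered by the vector `d`. -/
def borderedMatrix {k : ℕ} (d : Fin k → ℝ) (H : Matrix (Fin k) (Fin k) ℝ) :
    Matrix (Fin (k + 1)) (Fin (k + 1)) ℝ :=
  Matrix.of (Fin.cons (Fin.cons 0 d) fun i => Fin.cons (d i) (H i))

theorem det_borderedMatrix {k : ℕ} (d : Fin (k + 1) → ℝ) (H : Matrix (Fin (k + 1)) (Fin (k + 1)) ℝ)
    (hd : ∀ i : Fin k, d i.succ = 0) :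
    (borderedMatrix d H).det = -(d 0) ^ 2 * (H.submatrix Fin.succ Fin.succ).det := by
  have hc : ((borderedMatrix d H).submatrix Fin.succ (Fin.succAbove (Fin.succ 0))).det =
      d 0 * (H.submatrix Fin.succ Fin.succ).det := by
    have hs : ((borderedMatrix d H).submatrix Fin.succ (Fin.succAbove (Fin.succ 0))).submatrix
        (Fin.succAbove 0) Fin.succ = H.submatrix Fin.succ Fin.succ := by
      ext i j
      simp [borderedMatrix]
    rw [Matrix.det_succ_column_zero, Fin.sum_univ_succ, Finset.sum_eq_zero, hs]
    · simp [borderedMatrix]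
    · intro i _
      simp [borderedMatrix, hd]
  rw [Matrix.det_succ_row_zero, Fin.sum_univ_succ, Fin.sum_univ_succ, Finset.sum_eq_zero, hc]
  · simp [borderedMatrix]
    ring
  · intro i _
    simp [borderedMatrix, hd]

theorem det_borderedMatrix_congr {k : ℕ} (d : Fin k → ℝ) (H L : Matrix (Fin k) (Fin k) ℝ) :
    (borderedMatrix (Matrix.vecMul d L) (L.transpose * H * L)).det =
      L.det ^ 2 * (borderedMatrix d H).det := by
  let P : Matrix (Fin (k + 1)) (Fin (k + 1)) ℝ :=
    Matrix.of (Fin.cons (Fin.cons 1 0) fun i => Fin.cons 0 (L i))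
  have hP : P.det = L.det := by
    rw [Matrix.det_succ_row_zero, Fin.sum_univ_succ, Finset.sum_eq_zero]
    · have : P.submatrix Fin.succ (Fin.succAbove 0) = L := by
        ext i j
        simp [P]
      rw [this]
      simp [P]
    · intro i _
      simp [P]
  -- `P` is the block matrix `diag(1, L)`, so bordered matrices transform by congruence.
  have : borderedMatrix (Matrix.vecMul d L) (L.transpose * H * L) =
      P.transpose * borderedMatrix d H * P := by
    ext i j
    refine Fin.cases ?_ (fun i => ?_) i <;> refine Fin.cases ?_ (fun j => ?_) j <;>
      simp [P, borderedMatrix, Matrix.mul_apply, Fin.sum_univ_succ, Matrix.vecMul, dotProduct,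
        mul_comm]
  rw [this, Matrix.det_mul, Matrix.det_mul, Matrix.det_transpose, hP]
  ring

/-- The bordered Gram matrix of a bilinear form changes under a change of vectors by the square of
the determinant. -/
theorem det_mul_gram_eq {E : Type*} [AddCommGroup E] [Module ℝ E] {k : ℕ}
    (b : Module.Basis (Fin (k + 1)) ℝ E) (B : E →ₗ[ℝ] E →ₗ[ℝ] ℝ) (δ : E →ₗ[ℝ] ℝ) (w : E)
    (x : Fin k → E) (hx : ∀ i, δ (x i) = 0) :
    (b.det.curryLeft w x) ^ 2 *
        (borderedMatrix (fun i => δ (b i)) (Matrix.of fun i j => B (b i) (b j))).det =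
      -(δ w) ^ 2 * (Matrix.of fun i j => B (x i) (x j)).det := by
  -- Congruence by the matrix of `(w, x)` in the basis `b`; in the new border only the entry `δ w`
  -- survives, since `δ` kills each `x i`.
  rw [AlternatingMap.curryLeft_apply_apply, Module.Basis.det_apply, ← det_borderedMatrix_congr]
  set v : Fin (k + 1) → E := Matrix.vecCons w x with hv
  have h1 : Matrix.vecMul (fun i => δ (b i)) (b.toMatrix v) = fun i => δ (v i) := by
    ext i
    conv_rhs => rw [← b.sum_repr (v i), map_sum]
    simp [Matrix.vecMul, dotProduct, Module.Basis.toMatrix_apply, mul_comm]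
  have h2 : (b.toMatrix v).transpose * (Matrix.of fun i j => B (b i) (b j)) * b.toMatrix v =
      Matrix.of fun i j => B (v i) (v j) := by
    ext i j
    conv_rhs => rw [Matrix.of_apply, ← b.sum_repr (v i), ← b.sum_repr (v j)]
    simp only [Matrix.mul_apply, Matrix.transpose_apply, Matrix.of_apply,
      Module.Basis.toMatrix_apply, map_sum, map_smul, LinearMap.sum_apply, LinearMap.smul_apply,
      smul_eq_mul, Finset.sum_mul, Finset.mul_sum]
    refine Finset.sum_congr rfl fun k _ => Finset.sum_congr rfl fun l _ => ?_
    ring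
  rw [h1, h2, det_borderedMatrix _ _ (by simpa [hv] using hx)]
  rfl

/-- Over the product of a space of dimension `n` and an isotropic space of dimension `n + 1`, the
bordered determinant is, up to sign, the square of the determinant of the off-diagonal block. -/
theorem abs_det_borderedMatrix_isotropic {n : ℕ} (d : Fin (n + (n + 1)) → ℝ)
    (H : Matrix (Fin (n + (n + 1))) (Fin (n + (n + 1))) ℝ)
    (P : Matrix (Fin (n + 1)) (Fin (n + 1)) ℝ)
    (h0 : ∀ i j, H (Fin.natAdd n i) (Fin.natAdd n j) = 0)
    (hd : ∀ j, d (Fin.natAdd n j) = P 0 j)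
    (h1 : ∀ i j, H (Fin.castAdd (n + 1) i) (Fin.natAdd n j) = P i.succ j)
    (h2 : ∀ i j, H (Fin.natAdd n j) (Fin.castAdd (n + 1) i) = P i.succ j) :
    |(borderedMatrix d H).det| = P.det ^ 2 := by
  -- The left summand lists the border followed by the first `n` indices, the right summand the
  -- isotropic ones.
  let e : Fin (n + 1) ⊕ Fin (n + 1) ≃ Fin (n + (n + 1) + 1) :=
    finSumFinEquiv.trans (finCongr (by omega))
  have e0 : e (Sum.inl 0) = 0 := by ext; simp [e]
  have el : ∀ i : Fin n, e (Sum.inl i.succ) = (Fin.castAdd (n + 1) i).succ := by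
    intro i; ext; simp [e]
  have er : ∀ i : Fin (n + 1), e (Sum.inr i) = (Fin.natAdd n i).succ := by
    intro i; ext; simp [e]; omega
  -- Swapping the two column groups moves the isotropic block to the lower left corner and puts `P`
  -- and its transpose on the diagonal.
  have hblock : (borderedMatrix d H).submatrix e ((Equiv.sumComm _ _).trans e) =
      Matrix.fromBlocks P (Matrix.of fun i j => borderedMatrix d H (e (Sum.inl i)) (e (Sum.inl j)))
        0 P.transpose := by
    ext i j
    rcases i with i | i <;> rcases j with j | j
    · refine Fin.cases ?_ (fun i => ?_) i
      · simp [e0, er, borderedMatrix, hd]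
      · simp [el, er, borderedMatrix, h1]
    · simp
    · simp [er, borderedMatrix, h0]
    · refine Fin.cases ?_ (fun j => ?_) j
      · simp [e0, er, borderedMatrix, hd]
      · simp [el, er, borderedMatrix, h2]
  rw [← Matrix.abs_det_submatrix_equiv_equiv e ((Equiv.sumComm _ _).trans e), hblock,
    Matrix.det_fromBlocks_zero₂₁, Matrix.det_transpose, abs_mul, ← sq, sq_abs]

/-- The kernel of a linear form contains a family that a vector outside of it completes to a
basis. -/
theorem exists_ker_frame {E : Type*} [AddCommGroup E] [Module ℝ E] {k : ℕ}
    (b : Module.Basis (Fin (k + 1)) ℝ E) {δ : E →ₗ[ℝ] ℝ} {w : E} (hw : δ w ≠ 0) :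
    ∃ x : Fin k → E, (∀ i, δ (x i) = 0) ∧ b.det.curryLeft w x ≠ 0 := by
  have : FiniteDimensional ℝ E := b.finiteDimensional_of_finite
  have hfr : Module.finrank ℝ E = k + 1 := by
    simpa using Module.finrank_eq_card_basis b
  have hδ : δ ≠ 0 := fun h => hw (congrArg (fun L => L w) h)
  have hk : Module.finrank ℝ (LinearMap.ker δ) = k := by
    have := Module.Dual.finrank_ker_add_one_of_ne_zero hδ
    omega
  let e := Module.finBasisOfFinrankEq ℝ (LinearMap.ker δ) hk
  have hli : LinearIndependent ℝ (Fin.cons w fun i => (e i : E) : Fin (k + 1) → E) := by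
    refine linearIndependent_finCons.2
      ⟨e.linearIndependent.map' (LinearMap.ker δ).subtype (Submodule.ker_subtype _), ?_⟩
    intro hmem
    have : Submodule.span ℝ (Set.range fun i => (e i : E)) ≤ LinearMap.ker δ :=
      Submodule.span_le.2 (by rintro _ ⟨i, rfl⟩; exact (e i).2)
    exact hw (this hmem)
  refine ⟨fun i => e i, fun i => (e i).2, ?_⟩
  rw [AlternatingMap.curryLeft_apply_apply]
  have := b.isUnit_det (basisOfLinearIndependentOfCardEqFinrank hli (by simp [hfr]))
  rw [coe_basisOfLinearIndependentOfCardEqFinrank] at this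
  exact this.ne_zero

end Bordered

/-! ### The level sets of `F`: derivatives, retraction, tangent spaces -/

section Pairing

variable {n : ℕ} {M : Set (Fin n → ℝ)} {A : (Fin n → ℝ) → (Fin (n + 1) → ℝ)}
  {Q : (Fin n → ℝ) → ℝ}

theorem pairingFunction_add_vertical (z : Ambient n) (η : Fin (n + 1) → ℝ) :
    pairingFunction A Q (z + (0, η)) = pairingFunction A Q z + A z.1 ⬝ᵥ η := by
  simp only [pairingFunction, dotProduct, Prod.fst_add, Prod.snd_add, add_zero, Pi.add_apply,
    mul_add, Finset.sum_add_distrib]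
  ring

theorem contDiffOn_comp_fst {G : Type*} [NormedAddCommGroup G] [NormedSpace ℝ G]
    {f : (Fin n → ℝ) → G} (hf : ContDiffOn ℝ ∞ f M) :
    ContDiffOn ℝ ∞ (fun z : Ambient n => f z.1) (M ×ˢ Set.univ) :=
  hf.comp contDiff_fst.contDiffOn fun _ hz => hz.1

theorem contDiffOn_pairingFunction (hA : ContDiffOn ℝ ∞ A M) (hQ : ContDiffOn ℝ ∞ Q M) :
    ContDiffOn ℝ ∞ (pairingFunction A Q) (M ×ˢ Set.univ) := by
  unfold pairingFunction
  refine ContDiffOn.add (ContDiffOn.sum fun i _ => ContDiffOn.mul ?_ ?_) (contDiffOn_comp_fst hQ)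
  · exact contDiffOn_comp_fst (contDiffOn_pi.1 hA i)
  · exact ((contDiff_apply ℝ ℝ i).comp contDiff_snd).contDiffOn

theorem fderiv_pairingFunction_vertical (hMo : IsOpen M) (hA : ContDiffOn ℝ ∞ A M)
    (hQ : ContDiffOn ℝ ∞ Q M) {z : Ambient n} (hz : z.1 ∈ M) (η : Fin (n + 1) → ℝ) :
    fderiv ℝ (pairingFunction A Q) z (0, η) = A z.1 ⬝ᵥ η := by
  have hd := ContDiffOn.differentiableAt_of_isOpen (contDiffOn_pairingFunction hA hQ)
    (hMo.prod isOpen_univ) (p := z) ⟨hz, trivial⟩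
  rw [← hd.lineDeriv_eq_fderiv]
  refine HasLineDerivAt.lineDeriv ?_
  have : (fun s : ℝ => pairingFunction A Q (z + s • ((0, η) : Ambient n))) =
      fun s : ℝ => pairingFunction A Q z + s * (A z.1 ⬝ᵥ η) := by
    ext s
    rw [Prod.smul_mk, smul_zero, pairingFunction_add_vertical, dotProduct_smul, smul_eq_mul]
  rw [HasLineDerivAt, this]
  simpa using ((hasDerivAt_id (0 : ℝ)).mul_const (A z.1 ⬝ᵥ η)).const_add (pairingFunction A Q z)

/-- The vertical derivative `⟨A, η⟩` of `F` depends only on the base point and not on `Q`;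
differentiating it once more leaves `dA`. -/
theorem fderiv_fderiv_pairingFunction_vertical (hMo : IsOpen M) (hA : ContDiffOn ℝ ∞ A M)
    (hQ : ContDiffOn ℝ ∞ Q M) {z : Ambient n} (hz : z.1 ∈ M) (w : Ambient n)
    (η : Fin (n + 1) → ℝ) :
    fderiv ℝ (fderiv ℝ (pairingFunction A Q)) z w (0, η) = fderiv ℝ A z.1 w.1 ⬝ᵥ η := by
  have ho : IsOpen (M ×ˢ (Set.univ : Set (Fin (n + 1) → ℝ))) := hMo.prod isOpen_univ
  have hzD : z ∈ M ×ˢ (Set.univ : Set (Fin (n + 1) → ℝ)) := ⟨hz, trivial⟩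
  have hd := ContDiffOn.differentiableAt_of_isOpen
    ((contDiffOn_pairingFunction hA hQ).fderiv_of_isOpen ho (by simp) : ContDiffOn ℝ ∞ _ _) ho hzD
  have h1 : fderiv ℝ (fun x => fderiv ℝ (pairingFunction A Q) x ((0, η) : Ambient n)) z w =
      fderiv ℝ (fderiv ℝ (pairingFunction A Q)) z w (0, η) := by
    rw [fderiv_clm_apply hd (differentiableAt_const _)]
    simp
  have h2 : (fun x => fderiv ℝ (pairingFunction A Q) x ((0, η) : Ambient n)) =ᶠ[nhds z]
      fun x => A x.1 ⬝ᵥ η := by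
    filter_upwards [ho.mem_nhds hzD] with x hx
    exact fderiv_pairingFunction_vertical hMo hA hQ hx.1 η
  rw [← h1, h2.fderiv_eq]
  have hdA := (ContDiffOn.differentiableAt_of_isOpen hA hMo hz).hasFDerivAt
  have h3 : HasFDerivAt (fun x : Ambient n => A x.1)
      ((fderiv ℝ A z.1).comp (ContinuousLinearMap.fst ℝ _ _)) z :=
    hdA.comp z hasFDerivAt_fst
  have h4 := HasFDerivAt.fun_sum (u := Finset.univ)
    fun i _ => ((hasFDerivAt_pi'.1 h3 i).mul_const (η i))
  unfold dotProduct
  rw [h4.fderiv]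
  simp [mul_comm]

theorem dotProduct_self_ne_zero (hA : IsCentroaffineImmersion M A) {u : Fin n → ℝ} (hu : u ∈ M) :
    A u ⬝ᵥ A u ≠ 0 :=
  fun h => hA.ne_zero u hu (dotProduct_self_eq_zero.1 h)

/-- The smooth retraction of `M × ℝⁿ⁺¹*` onto the level set that moves along the fibers. -/
def levelRetraction (A : (Fin n → ℝ) → (Fin (n + 1) → ℝ)) (Q : (Fin n → ℝ) → ℝ) (t : ℝ)
    (z : Ambient n) : Ambient n :=
  z + ((t - pairingFunction A Q z) * (A z.1 ⬝ᵥ A z.1)⁻¹) • ((0, A z.1) : Ambient n)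

theorem levelRetraction_mem (hA : IsCentroaffineImmersion M A) {t : ℝ} {z : Ambient n}
    (hz : z.1 ∈ M) : levelRetraction A Q t z ∈ levelSet M A Q t := by
  refine ⟨by simpa [levelRetraction] using hz, ?_⟩
  rw [levelRetraction, Prod.smul_mk, smul_zero, pairingFunction_add_vertical, dotProduct_smul,
    smul_eq_mul, mul_assoc, inv_mul_cancel₀ (dotProduct_self_ne_zero hA hz)]
  ring

theorem levelRetraction_eq_self {t : ℝ} {z : Ambient n} (hz : z ∈ levelSet M A Q t) :
    levelRetraction A Q t z = z := by
  simp [levelRetraction, hz.2]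

theorem contDiffOn_dotProduct_inv (hA : IsCentroaffineImmersion M A) :
    ContDiffOn ℝ ∞ (fun z : Ambient n => (A z.1 ⬝ᵥ A z.1)⁻¹) (M ×ˢ Set.univ) := by
  refine ContDiffOn.inv ?_ fun z hz => dotProduct_self_ne_zero hA hz.1
  unfold dotProduct
  exact ContDiffOn.sum fun i _ => (contDiffOn_comp_fst (contDiffOn_pi.1 hA.smooth i)).mul
    (contDiffOn_comp_fst (contDiffOn_pi.1 hA.smooth i))

theorem contDiffOn_vertical (hA : IsCentroaffineImmersion M A) :
    ContDiffOn ℝ ∞ (fun z : Ambient n => ((0, A z.1) : Ambient n)) (M ×ˢ Set.univ) :=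
  contDiffOn_const.prodMk (contDiffOn_comp_fst hA.smooth)

theorem contDiffOn_levelRetraction (hA : IsCentroaffineImmersion M A) (hQ : ContDiffOn ℝ ∞ Q M)
    (t : ℝ) : ContDiffOn ℝ ∞ (levelRetraction A Q t) (M ×ˢ Set.univ) :=
  contDiffOn_id.add (((contDiffOn_const.sub (contDiffOn_pairingFunction hA.smooth hQ)).mul
    (contDiffOn_dotProduct_inv hA)).smul (contDiffOn_vertical hA))

/-- The level set is a retract of the connected set `M × ℝⁿ⁺¹*`, so it is its own only component. -/
theorem isConnected_levelSet (hMc : IsConnected M) (hA : IsCentroaffineImmersion M A)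
    (hQ : ContDiffOn ℝ ∞ Q M) (t : ℝ) : IsConnected (levelSet M A Q t) := by
  have : levelSet M A Q t = levelRetraction A Q t '' (M ×ˢ Set.univ) := by
    ext z
    constructor
    · exact fun hz => ⟨z, ⟨hz.1, trivial⟩, levelRetraction_eq_self hz⟩
    · rintro ⟨y, hy, rfl⟩
      exact levelRetraction_mem hA hy.1
  rw [this]
  exact (hMc.prod isConnected_univ).image _ (contDiffOn_levelRetraction hA hQ t).continuousOn

/-- The projection onto the kernel of the differential of the function `F`, along the fibers. -/
def tangentProjection (A : (Fin n → ℝ) → (Fin (n + 1) → ℝ)) (Q : (Fin n → ℝ) → ℝ)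
    (w z : Ambient n) : Ambient n :=
  w - (fderiv ℝ (pairingFunction A Q) z w * (A z.1 ⬝ᵥ A z.1)⁻¹) • ((0, A z.1) : Ambient n)

theorem fderiv_tangentProjection (hMo : IsOpen M) (hA : IsCentroaffineImmersion M A)
    (hQ : ContDiffOn ℝ ∞ Q M) {z : Ambient n} (hz : z.1 ∈ M) (w : Ambient n) :
    fderiv ℝ (pairingFunction A Q) z (tangentProjection A Q w z) = 0 := by
  rw [tangentProjection, map_sub, map_smul,
    fderiv_pairingFunction_vertical hMo hA.smooth hQ hz, smul_eq_mul, mul_assoc,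
    inv_mul_cancel₀ (dotProduct_self_ne_zero hA hz)]
  ring

theorem tangentProjection_eq_self {z w : Ambient n}
    (hw : fderiv ℝ (pairingFunction A Q) z w = 0) : tangentProjection A Q w z = w := by
  simp [tangentProjection, hw]

/-- The factor `t - F` vanishes on the level set, so only its own derivative contributes to that of
the correction term. -/
theorem fderiv_levelRetraction (hMo : IsOpen M) (hA : IsCentroaffineImmersion M A)
    (hQ : ContDiffOn ℝ ∞ Q M) {t : ℝ} {z : Ambient n} (hz : z ∈ levelSet M A Q t)
    (w : Ambient n) : fderiv ℝ (levelRetraction A Q t) z w = tangentProjection A Q w z := by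
  have ho : IsOpen (M ×ˢ (Set.univ : Set (Fin (n + 1) → ℝ))) := hMo.prod isOpen_univ
  have hzD : z ∈ M ×ˢ (Set.univ : Set (Fin (n + 1) → ℝ)) := ⟨hz.1, trivial⟩
  have hF := (ContDiffOn.differentiableAt_of_isOpen (contDiffOn_pairingFunction hA.smooth hQ)
    ho hzD).hasFDerivAt
  have hI := (ContDiffOn.differentiableAt_of_isOpen (contDiffOn_dotProduct_inv hA)
    ho hzD).hasFDerivAt
  have hV := (ContDiffOn.differentiableAt_of_isOpen (contDiffOn_vertical hA) ho hzD).hasFDerivAt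
  have := (hasFDerivAt_id z).add (((hF.const_sub t).mul hI).smul hV)
  have h2 : fderiv ℝ (levelRetraction A Q t) z = _ := this.fderiv
  rw [h2]
  simp [hz.2, tangentProjection, sub_eq_add_neg, mul_comm]

/-- The level set of `F` is cut out by `F`: its tangent spaces are the kernels of `dF`. -/
theorem isDefinedBy_levelSet (hMo : IsOpen M) (hA : IsCentroaffineImmersion M A)
    (hQ : ContDiffOn ℝ ∞ Q M) (t : ℝ) :
    IsDefinedBy (levelSet M A Q t) (M ×ˢ Set.univ) (pairingFunction A Q) where
  isOpen := hMo.prod isOpen_univ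
  subset := fun z hz => ⟨hz.1, trivial⟩
  smooth := contDiffOn_pairingFunction hA.smooth hQ
  mem_tangent := by
    have ho : IsOpen (M ×ˢ (Set.univ : Set (Fin (n + 1) → ℝ))) := hMo.prod isOpen_univ
    intro p hp v
    have hpD : p ∈ M ×ˢ (Set.univ : Set (Fin (n + 1) → ℝ)) := ⟨hp.1, trivial⟩
    constructor
    · intro hv
      have := hv _ (fun z => pairingFunction A Q z - t) ho hpD
        ((contDiffOn_pairingFunction hA.smooth hQ).sub contDiffOn_const)
        fun z hz => sub_eq_zero.2 hz.1.2
      rwa [fderiv_sub_const] at this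
    · intro hv U G hU hpU hG h0
      have hr := ContDiffOn.differentiableAt_of_isOpen (contDiffOn_levelRetraction hA hQ t) ho hpD
      have hGd := ContDiffOn.differentiableAt_of_isOpen hG hU hpU
      have hrp := levelRetraction_eq_self hp
      -- `G` composed with the retraction vanishes near `p`, while the derivative of the retraction
      -- fixes every `v` in `ker dF`.
      have hev : (fun z => G (levelRetraction A Q t z)) =ᶠ[nhds p] fun _ => 0 := by
        have hU' : U ∈ nhds (levelRetraction A Q t p) := hU.mem_nhds (by rwa [hrp])
        filter_upwards [hr.continuousAt.preimage_mem_nhds hU', ho.mem_nhds hpD] with z hz hzD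
        exact h0 _ ⟨levelRetraction_mem hA hzD.1, hz⟩
      have hc : HasFDerivAt (fun z => G (levelRetraction A Q t z))
          ((fderiv ℝ G p).comp (fderiv ℝ (levelRetraction A Q t) p)) p :=
        HasFDerivAt.comp p (by rw [hrp]; exact hGd.hasFDerivAt) hr.hasFDerivAt
      have h1 := congrArg (fun L => L v) (hc.fderiv.symm.trans hev.fderiv_eq)
      simpa [fderiv_levelRetraction hMo hA hQ hp, tangentProjection_eq_self hv] using h1

/-- Extends each tangent vector to a smooth tangent field, on which the conditions phrased for
fields can be tested. -/
theorem isTangentField_tangentProjection (hMo : IsOpen M) (hA : IsCentroaffineImmersion M A)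
    (hQ : ContDiffOn ℝ ∞ Q M) (t : ℝ) (w : Ambient n) :
    IsTangentField (levelSet M A Q t) (M ×ˢ Set.univ) (tangentProjection A Q w) := by
  have h := isDefinedBy_levelSet hMo hA hQ t
  refine ⟨h.isOpen, ?_, fun z hz => (h.mem_tangent z hz.1 _).2
    (fderiv_tangentProjection hMo hA hQ hz.1.1 w)⟩
  exact contDiffOn_const.sub (((h.contDiffOn_fderiv.clm_apply contDiffOn_const).mul
    (contDiffOn_dotProduct_inv hA)).smul (contDiffOn_vertical hA))

theorem isSmoothHypersurface_levelSet (hMo : IsOpen M) (hA : IsCentroaffineImmersion M A)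
    (hQ : ContDiffOn ℝ ∞ Q M) (t : ℝ) : IsSmoothHypersurface (levelSet M A Q t) := by
  intro p hp
  refine ⟨M ×ˢ Set.univ, fun z => pairingFunction A Q z - t, hMo.prod isOpen_univ, ⟨hp.1, trivial⟩,
    (contDiffOn_pairingFunction hA.smooth hQ).sub contDiffOn_const, fun x hx h0 => ?_, ?_⟩
  · rw [fderiv_sub_const] at h0
    have h1 := fderiv_pairingFunction_vertical hMo hA.smooth hQ hx.1 (A x.1)
    rw [h0] at h1
    exact dotProduct_self_ne_zero hA hx.1 h1.symm
  · ext z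
    simp only [levelSet, Set.mem_inter_iff, Set.mem_ofPred_eq, sub_eq_zero, Set.mem_prod,
      Set.mem_univ]
    tauto

/-! ### The frame of `A` and the equiaffine volume -/

/-- The matrix with rows the position vector and the partial derivatives of `A`. -/
def frameMatrix (A : (Fin n → ℝ) → (Fin (n + 1) → ℝ)) (u : Fin n → ℝ) :
    Matrix (Fin (n + 1)) (Fin (n + 1)) ℝ :=
  Matrix.of (Matrix.vecCons (A u) fun i => fderiv ℝ A u (Pi.single i 1))

theorem det_frameMatrix {κ : ℝ} {u : Fin n → ℝ}
    (h : pullbackRadialForm A u = κ • stdVolume n) : (frameMatrix A u).det = κ := by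
  have h1 := congrArg (fun f => f fun i => Pi.single i 1) h
  have h2 : stdVolume n (fun i => Pi.single i 1) = 1 := by
    rw [stdVolume]
    convert (Pi.basisFun ℝ (Fin n)).det_self using 2
    ext i : 1
    simp
  simp only [AlternatingMap.smul_apply, h2, smul_eq_mul, mul_one] at h1
  rw [← h1]
  simp only [pullbackRadialForm, AlternatingMap.compLinearMap_apply, radialForm,
    AlternatingMap.curryLeft_apply_apply, stdVolume, Pi.basisFun_det_apply]
  rfl

theorem eq_zero_of_dotProduct_eq_zero {u : Fin n → ℝ} (h : (frameMatrix A u).det ≠ 0)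
    {η : Fin (n + 1) → ℝ} (h0 : A u ⬝ᵥ η = 0) (h1 : ∀ v, fderiv ℝ A u v ⬝ᵥ η = 0) : η = 0 := by
  refine Matrix.eq_zero_of_mulVec_eq_zero h ?_
  ext i
  refine Fin.cases ?_ (fun i => ?_) i
  · simpa [frameMatrix, Matrix.mulVec] using h0
  · simpa [frameMatrix, Matrix.mulVec] using h1 _

/-- A tangent direction of `M` whose image is orthogonal to the annihilator of the position vector
vanishes. -/
theorem eq_zero_of_orthogonal (hA : IsCentroaffineImmersion M A) {u v : Fin n → ℝ} (hu : u ∈ M)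
    (h : ∀ η, A u ⬝ᵥ η = 0 → fderiv ℝ A u v ⬝ᵥ η = 0) : v = 0 := by
  have hAA := dotProduct_self_ne_zero hA hu
  -- The coefficient of the orthogonal projection of `dA(v)` to `A u`. The remainder is an
  -- admissible `η`, hence orthogonal to itself and zero; transversality then excludes `c ≠ 0`.
  set c := (fderiv ℝ A u v ⬝ᵥ A u) / (A u ⬝ᵥ A u) with hc
  have horth : A u ⬝ᵥ (fderiv ℝ A u v - c • A u) = 0 := by
    rw [dotProduct_sub, dotProduct_smul, hc, smul_eq_mul, div_mul_cancel₀ _ hAA, dotProduct_comm,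
      sub_self]
  have h1 := h _ horth
  have h2 : fderiv ℝ A u v - c • A u = 0 := by
    rw [← dotProduct_self_eq_zero, sub_dotProduct, smul_dotProduct, horth, h1]
    simp
  have hc0 : c = 0 := by
    by_contra hne
    refine hA.transverse u hu ⟨c⁻¹ • v, ?_⟩
    rw [map_smul, sub_eq_zero.1 h2, inv_smul_smul₀ hne]
  rw [hc0, zero_smul, sub_zero] at h2
  exact hA.immersion u hu (by rw [h2, map_zero])

/-- The standard basis of the ambient space, indexed compatibly with `ambientVolume`. -/
def ambientBasis (n : ℕ) : Module.Basis (Fin (n + n + 1)) ℝ (Ambient n) :=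
  ((Pi.basisFun ℝ (Fin n)).prod (Pi.basisFun ℝ (Fin (n + 1)))).reindex
    (finSumFinEquiv : Fin n ⊕ Fin (n + 1) ≃ Fin (n + (n + 1)))

theorem ambientVolume_eq (n : ℕ) : ambientVolume n = (ambientBasis n).det := rfl

theorem ambientBasis_castAdd (i : Fin n) :
    ambientBasis n (Fin.castAdd (n + 1) i) = (Pi.single i 1, 0) := by
  simp [ambientBasis, Module.Basis.reindex_apply]

theorem ambientBasis_natAdd (j : Fin (n + 1)) :
    ambientBasis n (Fin.natAdd n j) = (0, Pi.single j 1) := by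
  simp [ambientBasis, Module.Basis.reindex_apply]

/-- The equiaffine volume of tangent vectors and a transversal, in terms of the Gram determinant of
the second derivative of `F`. -/
theorem sq_ambientVolume_eq (hMo : IsOpen M) (hA : IsCentroaffineImmersion M A)
    (hQ : ContDiffOn ℝ ∞ Q M) {z : Ambient n} (hz : z.1 ∈ M) (w : Ambient n)
    {x : Fin (n + n) → Ambient n} (hx : ∀ i, fderiv ℝ (pairingFunction A Q) z (x i) = 0) :
    (frameMatrix A z.1).det ^ 2 * ((ambientVolume n).curryLeft w x) ^ 2 =
      (fderiv ℝ (pairingFunction A Q) z w) ^ 2 * |(Matrix.of fun i j =>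
        fderiv ℝ (fderiv ℝ (pairingFunction A Q)) z (x i) (x j)).det| := by
  set δ := fderiv ℝ (pairingFunction A Q) z with hδ
  set f := fderiv ℝ (fderiv ℝ (pairingFunction A Q)) z with hf
  have hsymm := (isDefinedBy_levelSet hMo hA hQ (pairingFunction A Q z)).fderiv_comm
    (p := z) ⟨hz, trivial⟩
  have hv := fderiv_fderiv_pairingFunction_vertical hMo hA.smooth hQ hz
  rw [← hf] at hsymm hv
  have hgram := det_mul_gram_eq (ambientBasis n)
    ((ContinuousLinearMap.coeLM ℝ).comp (f : Ambient n →ₗ[ℝ] Ambient n →L[ℝ] ℝ))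
    (δ : Ambient n →ₗ[ℝ] ℝ) w x hx
  have hiso := abs_det_borderedMatrix_isotropic (n := n) (fun i => δ (ambientBasis n i))
    (Matrix.of fun i j => f (ambientBasis n i) (ambientBasis n j)) (frameMatrix A z.1)
    (fun i j => ?_) (fun j => ?_) (fun i j => ?_) (fun i j => ?_)
  · have := congrArg abs hgram
    simp only [abs_mul, abs_neg, abs_pow, sq_abs] at this
    rw [← hiso, mul_comm, ambientVolume_eq]
    exact this
  · rw [Matrix.of_apply, ambientBasis_natAdd, ambientBasis_natAdd, hv]
    simp
  · rw [ambientBasis_natAdd, hδ, fderiv_pairingFunction_vertical hMo hA.smooth hQ hz]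
    simp [frameMatrix]
  · rw [Matrix.of_apply, ambientBasis_natAdd, ambientBasis_castAdd, hv]
    simp [frameMatrix]
  · rw [Matrix.of_apply, ambientBasis_natAdd, ambientBasis_castAdd, hsymm, hv]
    simp [frameMatrix]

end Pairing

/-! ### Nondegeneracy and the volume condition -/

section LevelSet

variable {n : ℕ} {M : Set (Fin n → ℝ)} {A : (Fin n → ℝ) → (Fin (n + 1) → ℝ)}
  {Q : (Fin n → ℝ) → ℝ} {t : ℝ}

/-- A vector that pairs to zero with the tangent space under the second derivative of `F` is
vertical, and annihilates the image of the differential of `A`. -/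
theorem vertical_of_fderiv_fderiv_eq_zero (hMo : IsOpen M) (hA : IsCentroaffineImmersion M A)
    (hQ : ContDiffOn ℝ ∞ Q M) {p ζ : Ambient n} (hp : p.1 ∈ M)
    (h : ∀ v, fderiv ℝ (pairingFunction A Q) p v = 0 →
      fderiv ℝ (fderiv ℝ (pairingFunction A Q)) p v ζ = 0) :
    ζ.1 = 0 ∧ ∀ y, fderiv ℝ A p.1 y ⬝ᵥ ζ.2 = 0 := by
  have hvert := fderiv_fderiv_pairingFunction_vertical hMo hA.smooth hQ hp
  have h1 : ζ.1 = 0 := by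
    -- Tested on the vertical tangent vectors `(0, η)` with `⟨A, η⟩ = 0`.
    refine eq_zero_of_orthogonal hA hp fun η hη => ?_
    rw [← hvert ζ η, (isDefinedBy_levelSet hMo hA hQ 0).fderiv_comm ⟨hp, trivial⟩]
    exact h _ (by rw [fderiv_pairingFunction_vertical hMo hA.smooth hQ hp, hη])
  refine ⟨h1, fun y => ?_⟩
  -- The projection of `(y, 0)` differs from it by a vertical vector, which is invisible to the
  -- vertical `ζ`.
  have h2 := h _ (fderiv_tangentProjection hMo hA hQ hp (y, 0))
  have h3 : ζ = (0, ζ.2) := Prod.ext h1 rfl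
  rw [h3, hvert] at h2
  simpa [tangentProjection] using h2

/-- A vector in the radical is vertical and annihilates `dA`; being tangent it also annihilates `A`,
hence every row of the invertible frame matrix. -/
theorem eq_zero_of_fderiv_fderiv_eq_zero (hMo : IsOpen M) (hA : IsCentroaffineImmersion M A)
    (hQ : ContDiffOn ℝ ∞ Q M) {p v : Ambient n} (hp : p.1 ∈ M)
    (hdet : (frameMatrix A p.1).det ≠ 0) (hv : fderiv ℝ (pairingFunction A Q) p v = 0)
    (h : ∀ w, fderiv ℝ (pairingFunction A Q) p w = 0 →
      fderiv ℝ (fderiv ℝ (pairingFunction A Q)) p w v = 0) : v = 0 := by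
  obtain ⟨h1, h2⟩ := vertical_of_fderiv_fderiv_eq_zero hMo hA hQ hp h
  have h3 : v = (0, v.2) := Prod.ext h1 rfl
  rw [h3, fderiv_pairingFunction_vertical hMo hA.smooth hQ hp] at hv
  rw [h3, eq_zero_of_dotProduct_eq_zero hdet hv h2]
  rfl

theorem isNondegenerate_levelSet (hMo : IsOpen M) (hA : IsCentroaffineImmersion M A)
    (hdet : ∀ u ∈ M, (frameMatrix A u).det ≠ 0) (hQ : ContDiffOn ℝ ∞ Q M) :
    IsNondegenerate (levelSet M A Q t) := by
  intro p hp v hv hv0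
  have hdef := isDefinedBy_levelSet hMo hA hQ t
  by_contra! hcon
  have hv' := (hdef.mem_tangent p hp v).1 hv
  refine hv0 (eq_zero_of_fderiv_fderiv_eq_zero hMo hA hQ hp.1 (hdet _ hp.1) hv' fun w hw => ?_)
  have hX := isTangentField_tangentProjection hMo hA hQ t w
  have h1 := (hdef.mem_tangent p hp _).1 (hcon _ _ (show p ∈ M ×ˢ Set.univ from ⟨hp.1, trivial⟩) hX)
  rw [hdef.fderiv_tangentField hX ⟨hp, hp.1, trivial⟩ hv', tangentProjection_eq_self hw,
    neg_eq_zero] at h1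
  rw [hdef.fderiv_comm ⟨hp.1, trivial⟩, h1]

/-- The volume density induced by a transversal is that of its metric exactly when `dF` takes the
right value on it. -/
theorem volume_density_iff (hMo : IsOpen M) (hA : IsCentroaffineImmersion M A)
    (hQ : ContDiffOn ℝ ∞ Q M) {ξ : Ambient n → Ambient n} {U : Set (Ambient n)}
    {X : Fin (n + n) → Ambient n → Ambient n} (hX : ∀ i, IsTangentField (levelSet M A Q t) U (X i))
    {p : Ambient n} (hp : p ∈ levelSet M A Q t ∩ U) (hdet : (frameMatrix A p.1).det ≠ 0)
    (hξ : fderiv ℝ (pairingFunction A Q) p (ξ p) ≠ 0) :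
    (|inducedVolume (ambientVolume n) ξ p (fun i => X i p)| =
      √|(Matrix.of fun i j => secondForm (levelSet M A Q t) ξ (X i) (X j) p).det|) ↔
    (inducedVolume (ambientVolume n) ξ p (fun i => X i p) = 0 ∨
      fderiv ℝ (pairingFunction A Q) p (ξ p) ^ (n + n + 2) = (frameMatrix A p.1).det ^ 2) := by
  have hdef := isDefinedBy_levelSet hMo hA hQ t
  have hgram := sq_ambientVolume_eq hMo hA hQ hp.1.1 (ξ p) (x := fun i => X i p)
    fun i => (hdef.mem_tangent p hp.1 _).1 ((hX i).2.2 p hp)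
  rw [← hdef.det_secondForm hX hp hξ] at hgram
  set H := |(Matrix.of fun i j => secondForm (levelSet M A Q t) ξ (X i) (X j) p).det|
  set φ := fderiv ℝ (pairingFunction A Q) p (ξ p)
  set κ := (frameMatrix A p.1).det
  have hφ : |φ| ^ (n + n) = φ ^ (n + n) := Even.pow_abs ⟨n, rfl⟩ φ
  rw [hφ] at hgram
  change κ ^ 2 * inducedVolume (ambientVolume n) ξ p (fun i => X i p) ^ 2 = _ at hgram
  set V := inducedVolume (ambientVolume n) ξ p (fun i => X i p)
  -- Of the exponent, `2n` comes from scaling the Hessian to the metric and `2` from the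
  -- transversal. The case `V = 0` below accounts for dependent fields.
  have hgram' : κ ^ 2 * V ^ 2 = φ ^ (n + n + 2) * H := by
    rw [hgram]
    ring
  have hφ0 : φ ^ (n + n + 2) ≠ 0 := pow_ne_zero _ hξ
  have hiff : |V| = √H ↔ V ^ 2 = H := by
    rw [← Real.sqrt_sq_eq_abs, Real.sqrt_inj (sq_nonneg _) (abs_nonneg _)]
  rw [hiff]
  constructor
  · intro h
    by_cases hV : V = 0
    · exact Or.inl hV
    · right
      rw [← h] at hgram'
      exact (mul_right_cancel₀ (pow_ne_zero 2 hV) hgram').symm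
  · rintro (h | h)
    · rw [h] at hgram' ⊢
      rw [zero_pow two_ne_zero, mul_zero, zero_eq_mul] at hgram'
      rw [hgram'.resolve_left hφ0, zero_pow two_ne_zero]
    · rw [h] at hgram'
      exact mul_left_cancel₀ (pow_ne_zero 2 hdet) hgram'

/-! ### Properties of an equiaffine normal -/

section EquiaffineNormal

variable {ξ : Ambient n → Ambient n}

theorem IsEquiaffineNormal.pow_fderiv_eq (hMo : IsOpen M) (hA : IsCentroaffineImmersion M A)
    (hdet : ∀ u ∈ M, (frameMatrix A u).det ≠ 0) (hQ : ContDiffOn ℝ ∞ Q M)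
    (h : IsEquiaffineNormal (ambientVolume n) (levelSet M A Q t) ξ) {p : Ambient n}
    (hp : p ∈ levelSet M A Q t) :
    fderiv ℝ (pairingFunction A Q) p (ξ p) ^ (n + n + 2) = (frameMatrix A p.1).det ^ 2 := by
  have hξ := (isDefinedBy_levelSet hMo hA hQ t).fderiv_apply_ne_zero h.transversal hp
  obtain ⟨x, hx, hV⟩ := exists_ker_frame (ambientBasis n)
    (δ := (fderiv ℝ (pairingFunction A Q) p : Ambient n →ₗ[ℝ] ℝ)) hξ
  have hX := fun i => isTangentField_tangentProjection hMo hA hQ t (x i)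
  have hpD : p ∈ levelSet M A Q t ∩ M ×ˢ Set.univ := ⟨hp, hp.1, trivial⟩
  refine ((volume_density_iff hMo hA hQ hX hpD (hdet _ hp.1) hξ).1
    (h.volume_eq _ _ hX p hpD)).resolve_left ?_
  have : (fun i => tangentProjection A Q (x i) p) = x :=
    funext fun i => tangentProjection_eq_self (hx i)
  rw [this]
  exact hV

/-- This is the vanishing of the connection form: parallelism makes the volume of `D_v ξ` with a
tangent frame zero, so `D_v ξ` is tangent. -/
theorem IsEquiaffineNormal.fderiv_fderiv_eq_zero (hMo : IsOpen M)
    (hA : IsCentroaffineImmersion M A) (hdet : ∀ u ∈ M, (frameMatrix A u).det ≠ 0)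
    (hQ : ContDiffOn ℝ ∞ Q M) (h : IsEquiaffineNormal (ambientVolume n) (levelSet M A Q t) ξ)
    {p v : Ambient n} (hp : p ∈ levelSet M A Q t)
    (hv : fderiv ℝ (pairingFunction A Q) p v = 0) :
    fderiv ℝ (pairingFunction A Q) p (fderiv ℝ ξ p v) = 0 := by
  have hdef := isDefinedBy_levelSet hMo hA hQ t
  have hξ := hdef.fderiv_apply_ne_zero h.transversal hp
  obtain ⟨W, hW, hSW, hξW⟩ := h.transversal.1
  obtain ⟨x, hx, hV⟩ := exists_ker_frame (ambientBasis n)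
    (δ := (fderiv ℝ (pairingFunction A Q) p : Ambient n →ₗ[ℝ] ℝ)) hξ
  have hX := fun i => isTangentField_tangentProjection hMo hA hQ t (x i)
  have hxp : (fun i => tangentProjection A Q (x i) p) = x :=
    funext fun i => tangentProjection_eq_self (hx i)
  have hpD : p ∈ levelSet M A Q t ∩ M ×ˢ Set.univ := ⟨hp, hp.1, trivial⟩
  have hpar := (fderiv_inducedVolume_eq_iff (ambientBasis n)
    (ContDiffOn.differentiableAt_of_isOpen hξW hW (hSW hp)) fun i =>
      ContDiffOn.differentiableAt_of_isOpen (hX i).2.1 (hX i).1 hpD.2).1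
    (h.volume_parallel _ _ _ (isTangentField_tangentProjection hMo hA hQ t v) hX p hpD)
  rw [hxp, tangentProjection_eq_self hv] at hpar
  -- `g1` shows that the Gram determinant of the frame is nonzero, and `g2` then forces `dF(D_v ξ) =
  -- 0`.
  have g1 := sq_ambientVolume_eq hMo hA hQ hp.1 (ξ p) hx
  have g2 := sq_ambientVolume_eq hMo hA hQ hp.1 (fderiv ℝ ξ p v) hx
  rw [ambientVolume_eq, hpar, zero_pow two_ne_zero, mul_zero, zero_eq_mul] at g2
  refine pow_eq_zero_iff two_ne_zero |>.1 (g2.resolve_right fun h0 => ?_)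
  rw [h0, mul_zero] at g1
  exact mul_ne_zero (pow_ne_zero 2 (hdet _ hp.1)) (pow_ne_zero 2 hV) g1

/-- The equiaffine normal is vertical, and annihilates the image of the differential of `A`. -/
theorem IsEquiaffineNormal.vertical (hMo : IsOpen M) (hA : IsCentroaffineImmersion M A)
    {κ : ℝ} (hκ : κ ≠ 0) (hdet : ∀ u ∈ M, (frameMatrix A u).det = κ) (hQ : ContDiffOn ℝ ∞ Q M)
    (h : IsEquiaffineNormal (ambientVolume n) (levelSet M A Q t) ξ) {p : Ambient n}
    (hp : p ∈ levelSet M A Q t) : (ξ p).1 = 0 ∧ ∀ y, fderiv ℝ A p.1 y ⬝ᵥ (ξ p).2 = 0 := by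
  have hdet' : ∀ u ∈ M, (frameMatrix A u).det ≠ 0 := fun u hu => by rwa [hdet u hu]
  have hdef := isDefinedBy_levelSet hMo hA hQ t
  obtain ⟨W, hW, hSW, hξW⟩ := h.transversal.1
  refine vertical_of_fderiv_fderiv_eq_zero hMo hA hQ hp.1 fun v hv => ?_
  have hsm : ContDiffOn ℝ ∞ (fun x => fderiv ℝ (pairingFunction A Q) x (ξ x))
      (M ×ˢ Set.univ ∩ W) :=
    (hdef.contDiffOn_fderiv.mono Set.inter_subset_left).clm_apply
      (hξW.mono Set.inter_subset_right)
  have ho := hdef.isOpen.inter hW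
  have hpU : p ∈ M ×ˢ Set.univ ∩ W := ⟨hdef.subset hp, hSW hp⟩
  -- The constancy of `κ` enters here: `dF(ξ) ^ (2n + 2)` has zero derivative along the level set,
  -- and so does `dF(ξ)`, which is nonzero.
  have h0 := (hdef.mem_tangent p hp v).2 hv (M ×ˢ Set.univ ∩ W)
    (fun x => fderiv ℝ (pairingFunction A Q) x (ξ x) ^ (n + n + 2) - κ ^ 2) ho hpU
    ((hsm.pow _).sub contDiffOn_const) fun x hx => by
      rw [h.pow_fderiv_eq hMo hA hdet' hQ hx.1, hdet _ hx.1.1, sub_self]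
  have hd := (ContDiffOn.differentiableAt_of_isOpen hsm ho hpU).hasFDerivAt
  rw [fderiv_sub_const, (hd.pow (n + n + 2)).fderiv] at h0
  simp only [smul_apply, smul_eq_mul, nsmul_eq_mul, mul_eq_zero,
    pow_eq_zero_iff', hdef.fderiv_apply_ne_zero h.transversal hp, false_and, or_false] at h0
  have h1 := h0.resolve_left (by positivity)
  rwa [hdef.fderiv_apply hW hξW ⟨hp, hSW hp⟩, h.fderiv_fderiv_eq_zero hMo hA hdet' hQ hp hv,
    add_zero] at h1

theorem IsEquiaffineNormal.shapeOperator_eq (hMo : IsOpen M) (hA : IsCentroaffineImmersion M A)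
    (hdet : ∀ u ∈ M, (frameMatrix A u).det ≠ 0) (hQ : ContDiffOn ℝ ∞ Q M)
    (h : IsEquiaffineNormal (ambientVolume n) (levelSet M A Q t) ξ) {p v : Ambient n}
    (hp : p ∈ levelSet M A Q t) (hv : fderiv ℝ (pairingFunction A Q) p v = 0) :
    shapeOperator (levelSet M A Q t) ξ p v = - fderiv ℝ ξ p v := by
  have hdef := isDefinedBy_levelSet hMo hA hQ t
  rw [shapeOperator, connectionForm,
    hdef.conormal_eq hp (hdef.fderiv_apply_ne_zero h.transversal hp),
    h.fderiv_fderiv_eq_zero hMo hA hdet hQ hp hv]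
  simp

/-- If the shape operator is a multiple of the identity at `p`, then it vanishes at `p`. -/
theorem IsEquiaffineNormal.shapeOperator_eq_zero (hMo : IsOpen M)
    (hA : IsCentroaffineImmersion M A) {κ : ℝ} (hκ : κ ≠ 0)
    (hdet : ∀ u ∈ M, (frameMatrix A u).det = κ) (hQ : ContDiffOn ℝ ∞ Q M)
    (h : IsEquiaffineNormal (ambientVolume n) (levelSet M A Q t) ξ) {p v : Ambient n} {c : ℝ}
    (hp : p ∈ levelSet M A Q t)
    (hc : ∀ v ∈ tangentSpaceAt (levelSet M A Q t) p,
      shapeOperator (levelSet M A Q t) ξ p v = c • v)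
    (hv : v ∈ tangentSpaceAt (levelSet M A Q t) p) :
    shapeOperator (levelSet M A Q t) ξ p v = 0 := by
  have hdet' : ∀ u ∈ M, (frameMatrix A u).det ≠ 0 := fun u hu => by rwa [hdet u hu]
  have hdef := isDefinedBy_levelSet hMo hA hQ t
  obtain ⟨W, hW, hSW, hξW⟩ := h.transversal.1
  -- The base components of `ξ` vanish along the level set, so `D_v ξ` is vertical.
  have hhor : ∀ v ∈ tangentSpaceAt (levelSet M A Q t) p, c • v.1 = 0 := by
    intro v hv
    have h1 := hc v hv
    rw [h.shapeOperator_eq hMo hA hdet' hQ hp ((hdef.mem_tangent p hp v).1 hv)] at h1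
    rw [← Prod.smul_fst, ← h1]
    ext i
    have hξi : ContDiffOn ℝ ∞ (fun x => (ξ x).1 i) W :=
      ((contDiff_apply ℝ ℝ i).comp contDiff_fst).comp_contDiffOn hξW
    have h2 := hv W (fun x => (ξ x).1 i) hW (hSW hp) hξi fun x hx => by
      rw [(h.vertical hMo hA hκ hdet hQ hx.1).1]
      rfl
    have hd := (ContDiffOn.differentiableAt_of_isOpen hξW hW (hSW hp)).hasFDerivAt
    have h3 := (hasFDerivAt_pi'.1 hd.fst i).fderiv
    rw [h3] at h2
    simpa using h2
  rw [hc v hv, smul_eq_zero]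
  by_contra! hcon
  obtain ⟨hc0, hv0⟩ := hcon
  -- With `c ≠ 0` the whole tangent space would be vertical, hence isotropic, contradicting
  -- nondegeneracy unless it is zero. No case distinction on `n` is needed.
  have hfst : ∀ w ∈ tangentSpaceAt (levelSet M A Q t) p, w.1 = 0 := fun w hw =>
    (smul_eq_zero.1 (hhor w hw)).resolve_left hc0
  have hv' := (hdef.mem_tangent p hp v).1 hv
  refine hv0 (eq_zero_of_fderiv_fderiv_eq_zero hMo hA hQ hp.1 (hdet' _ hp.1) hv' fun w hw => ?_)
  have h3 : v = (0, v.2) := Prod.ext (hfst v hv) rfl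
  rw [h3, fderiv_fderiv_pairingFunction_vertical hMo hA.smooth hQ hp.1,
    hfst w ((hdef.mem_tangent p hp w).2 hw)]
  simp

theorem fderiv_dotProduct_const (hMo : IsOpen M) (hA : ContDiffOn ℝ ∞ A M) {u : Fin n → ℝ}
    (hu : u ∈ M) (a : Fin (n + 1) → ℝ) (y : Fin n → ℝ) :
    DifferentiableAt ℝ (fun u => A u ⬝ᵥ a) u ∧
      fderiv ℝ (fun u => A u ⬝ᵥ a) u y = fderiv ℝ A u y ⬝ᵥ a := by
  have hd := (ContDiffOn.differentiableAt_of_isOpen hA hMo hu).hasFDerivAt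
  have h := HasFDerivAt.fun_sum (u := Finset.univ)
    fun i _ => ((hasFDerivAt_pi'.1 hd i).mul_const (a i))
  unfold dotProduct
  refine ⟨h.differentiableAt, ?_⟩
  rw [h.fderiv]
  simp [mul_comm]

/-- If the shape operator vanishes, then the equiaffine normal is constant, and the image of `A`
lies in a hyperplane. -/
theorem IsEquiaffineNormal.imageInHyperplane (hMo : IsOpen M) (hMc : IsConnected M)
    (hA : IsCentroaffineImmersion M A) {κ : ℝ} (hκ : κ ≠ 0)
    (hdet : ∀ u ∈ M, (frameMatrix A u).det = κ) (hQ : ContDiffOn ℝ ∞ Q M)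
    (h : IsEquiaffineNormal (ambientVolume n) (levelSet M A Q t) ξ)
    (h0 : ∀ p ∈ levelSet M A Q t, ∀ v ∈ tangentSpaceAt (levelSet M A Q t) p,
      shapeOperator (levelSet M A Q t) ξ p v = 0) : ImageInHyperplane M A := by
  have hdet' : ∀ u ∈ M, (frameMatrix A u).det ≠ 0 := fun u hu => by rwa [hdet u hu]
  have hdef := isDefinedBy_levelSet hMo hA hQ t
  obtain ⟨W, hW, hSW, hξW⟩ := h.transversal.1
  -- A smooth section of the level set over `M`; along it `ξ` has zero derivative.
  let s : (Fin n → ℝ) → Ambient n := fun u => levelRetraction A Q t (u, 0)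
  have hs : ∀ u ∈ M, s u ∈ levelSet M A Q t := fun u hu => levelRetraction_mem hA hu
  have hs1 : ∀ u, (s u).1 = u := fun u => by simp [s, levelRetraction]
  have hsd : ContDiffOn ℝ ∞ s M :=
    (contDiffOn_levelRetraction hA hQ t).comp (contDiff_id.prodMk contDiff_const).contDiffOn
      fun u hu => ⟨hu, trivial⟩
  have hξs : ∀ u ∈ M, HasFDerivAt (fun u => ξ (s u)) (0 : (Fin n → ℝ) →L[ℝ] Ambient n) u := by
    intro u hu
    have h1 := (ContDiffOn.differentiableAt_of_isOpen hsd hMo hu).hasFDerivAt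
    have h2 := (ContDiffOn.differentiableAt_of_isOpen hξW hW (hSW (hs u hu))).hasFDerivAt
    suffices hz : (fderiv ℝ ξ (s u)).comp (fderiv ℝ s u) = 0 from hz ▸ h2.comp u h1
    ext1 y
    have hF := (ContDiffOn.differentiableAt_of_isOpen hdef.smooth hdef.isOpen
      (hdef.subset (hs u hu))).hasFDerivAt.comp u h1
    have hev : (pairingFunction A Q ∘ s) =ᶠ[nhds u] fun _ => t := by
      filter_upwards [hMo.mem_nhds hu] with x hx
      exact (hs x hx).2
    have htan : fderiv ℝ (pairingFunction A Q) (s u) (fderiv ℝ s u y) = 0 := by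
      have := congrArg (fun L => L y) (hF.fderiv.symm.trans hev.fderiv_eq)
      simpa using this
    have h3 := h0 _ (hs u hu) _ ((hdef.mem_tangent _ (hs u hu) _).2 htan)
    rw [h.shapeOperator_eq hMo hA hdet' hQ (hs u hu) htan, neg_eq_zero] at h3
    simpa using h3
  obtain ⟨u₀, hu₀⟩ := hMc.nonempty
  have hconst : ∀ u ∈ M, ξ (s u) = ξ (s u₀) := fun u hu =>
    hMo.is_const_of_fderiv_eq_zero (𝕜 := ℝ) hMc.isPreconnected
      (fun x hx => (hξs x hx).differentiableAt.differentiableWithinAt)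
      (fun x hx => (hξs x hx).fderiv) hu hu₀
  -- The constant fiber component of `ξ` is the covector of the hyperplane: it annihilates `dA` at
  -- every point of `M`.
  refine ⟨(ξ (s u₀)).2, A u₀ ⬝ᵥ (ξ (s u₀)).2, fun ha => ?_, ?_⟩
  · refine hdef.fderiv_apply_ne_zero h.transversal (hs u₀ hu₀) ?_
    have : ξ (s u₀) = 0 := Prod.ext (h.vertical hMo hA hκ hdet hQ (hs u₀ hu₀)).1 ha
    rw [this, map_zero]
  · rintro _ ⟨u, hu, rfl⟩
    refine hMo.is_const_of_fderiv_eq_zero (𝕜 := ℝ) (f := fun u => A u ⬝ᵥ (ξ (s u₀)).2)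
      hMc.isPreconnected (fun x hx => (fderiv_dotProduct_const hMo hA.smooth hx _
        0).1.differentiableWithinAt) (fun x hx => ?_) hu hu₀
    ext1 y
    rw [(fderiv_dotProduct_const hMo hA.smooth hx _ y).2]
    have := (h.vertical hMo hA hκ hdet hQ (hs x hx)).2 y
    rwa [hconst x hx, hs1] at this

end EquiaffineNormal

/-- If the image of `A` lies in a hyperplane, then a constant multiple of its conormal is an
equiaffine normal of the level set, with vanishing shape operator. -/
theorem isImproperAffineSphere_levelSet (hMo : IsOpen M) (hMc : IsConnected M)
    (hA : IsCentroaffineImmersion M A) {κ : ℝ} (hκ : κ ≠ 0)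
    (hdet : ∀ u ∈ M, (frameMatrix A u).det = κ) (hQ : ContDiffOn ℝ ∞ Q M)
    (h : ImageInHyperplane M A) :
    IsImproperAffineSphere (ambientVolume n) (levelSet M A Q t) := by
  have hdet' : ∀ u ∈ M, (frameMatrix A u).det ≠ 0 := fun u hu => by rwa [hdet u hu]
  have hdef := isDefinedBy_levelSet hMo hA hQ t
  obtain ⟨a, c, ha, hac⟩ := h
  have hc : ∀ u ∈ M, A u ⬝ᵥ a = c := fun u hu => hac ⟨u, hu, rfl⟩
  have hda : ∀ u ∈ M, ∀ y, fderiv ℝ A u y ⬝ᵥ a = 0 := by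
    intro u hu y
    rw [← (fderiv_dotProduct_const hMo hA.smooth hu a y).2]
    have : (fun u => A u ⬝ᵥ a) =ᶠ[nhds u] fun _ => c := by
      filter_upwards [hMo.mem_nhds hu] with x hx
      exact hc x hx
    rw [this.fderiv_eq]
    simp
  -- A hyperplane through the origin would make `a` annihilate both `A` and `dA`.
  have hc0 : c ≠ 0 := by
    obtain ⟨u, hu⟩ := hMc.nonempty
    rintro rfl
    exact ha (eq_zero_of_dotProduct_eq_zero (hdet' u hu) (hc u hu) (hda u hu))
  -- The required value of `dF(ξ)`, since `r ^ (2n + 2) = κ ^ 2`.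
  obtain ⟨r, hr⟩ : ∃ r : ℝ, r ^ (n + 1) = |κ| :=
    ⟨_, Real.rpow_inv_natCast_pow (abs_nonneg κ) n.succ_ne_zero⟩
  have hr0 : r ≠ 0 := by
    rintro rfl
    rw [zero_pow n.succ_ne_zero] at hr
    exact hκ (abs_eq_zero.1 hr.symm)
  let ξ : Ambient n → Ambient n := fun _ => (0, (r / c) • a)
  have hξF : ∀ p ∈ levelSet M A Q t, fderiv ℝ (pairingFunction A Q) p (ξ p) = r := by
    intro p hp
    rw [fderiv_pairingFunction_vertical hMo hA.smooth hQ hp.1, dotProduct_smul, hc _ hp.1,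
      smul_eq_mul, div_mul_cancel₀ _ hc0]
  have hξd : ∀ p, fderiv ℝ ξ p = 0 := fun p => by simp [ξ]
  refine ⟨isSmoothHypersurface_levelSet hMo hA hQ t, isNondegenerate_levelSet hMo hA hdet' hQ, ξ,
    ⟨⟨⟨Set.univ, isOpen_univ, Set.subset_univ _, contDiffOn_const⟩, fun p hp hmem => ?_⟩, ?_, ?_⟩,
    fun p hp v hv => ?_⟩
  · rw [hdef.mem_tangent p hp, hξF p hp] at hmem
    exact hr0 hmem
  · intro U X hX p hp
    refine (volume_density_iff hMo hA hQ hX hp (hdet' _ hp.1.1) (by rwa [hξF p hp.1])).2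
      (Or.inr ?_)
    rw [hξF p hp.1, hdet _ hp.1.1, ← sq_abs κ, ← hr]
    ring
  · intro U Y X hY hX p hp
    refine (fderiv_inducedVolume_eq_iff (ambientBasis n) (differentiableAt_const _) fun i =>
      ContDiffOn.differentiableAt_of_isOpen (hX i).2.1 (hX i).1 hp.2).2 ?_
    rw [hξd]
    simp
  · rw [shapeOperator, connectionForm, hξd]
    simp

end LevelSet

end EquiaffineLevelSets

end

/-! ### The characterization of affine spheres -/

theorem lemma3p3 (n : ℕ) (M : Set (Fin n → ℝ)) (hMo : IsOpen M) (hMc : IsConnected M)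
    (A : (Fin n → ℝ) → (Fin (n + 1) → ℝ))
    (hA : EquiaffineLevelSets.IsCentroaffineImmersion M A)
    (κ : ℝ) (hκ : κ ≠ 0)
    (hAκ : ∀ u ∈ M, EquiaffineLevelSets.pullbackRadialForm A u =
      κ • EquiaffineLevelSets.stdVolume n)
    (Q : (Fin n → ℝ) → ℝ) (hQ : ContDiffOn ℝ ∞ Q M)
    (t : ℝ) (S : Set (EquiaffineLevelSets.Ambient n))
    (hS : ∃ p ∈ EquiaffineLevelSets.levelSet M A Q t,
      S = connectedComponentIn (EquiaffineLevelSets.levelSet M A Q t) p) :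
    (EquiaffineLevelSets.IsAffineSphere (EquiaffineLevelSets.ambientVolume n) S ↔
      EquiaffineLevelSets.ImageInHyperplane M A) ∧
    (EquiaffineLevelSets.IsAffineSphere (EquiaffineLevelSets.ambientVolume n) S →
      EquiaffineLevelSets.IsImproperAffineSphere (EquiaffineLevelSets.ambientVolume n) S) := by
  have hdet : ∀ u ∈ M, (EquiaffineLevelSets.frameMatrix A u).det = κ := fun u hu =>
    EquiaffineLevelSets.det_frameMatrix (hAκ u hu)
  obtain ⟨p, hp, rfl⟩ := hS
  rw [(EquiaffineLevelSets.isConnected_levelSet hMc hA hQ t).isPreconnected.connectedComponentIn hp]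
  refine ⟨⟨?_, fun h => ?_⟩, ?_⟩
  · rintro ⟨-, -, ξ, hξ, hc⟩
    refine hξ.imageInHyperplane hMo hMc hA hκ hdet hQ fun q hq v hv => ?_
    obtain ⟨c, hcq⟩ := hc q hq
    exact hξ.shapeOperator_eq_zero hMo hA hκ hdet hQ hq hcq hv
  · obtain ⟨h1, h2, ξ, hξ, h0⟩ :=
      EquiaffineLevelSets.isImproperAffineSphere_levelSet (t := t) hMo hMc hA hκ hdet hQ h
    exact ⟨h1, h2, ξ, hξ, fun q hq => ⟨0, fun v hv => by rw [h0 q hq v hv, zero_smul]⟩⟩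
  · rintro ⟨h1, h2, ξ, hξ, hc⟩
    refine ⟨h1, h2, ξ, hξ, fun q hq v hv => ?_⟩
    obtain ⟨c, hcq⟩ := hc q hq
    exact hξ.shapeOperator_eq_zero hMo hA hκ hdet hQ hq hcq hv
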